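/- A \emph{signature} is a sequence of sets $\Phi=(\Phi_n)_{n\in\mathbb N}$. An $n$-ary $\Phi$-term is built from the variables $x_1,\dots,x_n$ and the operation symbols in $\Phi$. If the variables occurring in an $n$-ary term $t$, read from left to right with repetitions, are $x_{i_1},\dots,x_{i_m}$, the \emph{labelling function} of $t$ is the function $\{1,\dots,m\}\to\{1,\dots,n\}$, $j\mapsto i_j$. The $n$-ary term $t$ is \emph{linear} if its labelling function is a bijection, and \emph{strongly regular} if $m=n$ and its labelling function is the identity. A \emph{presentation} $(\Phi,E)$ is a signature $\Phi$ with a set $E$ of equations, each of which is a pair of $n$-ary $\Phi$-terms for some $n$; it is linear (strongly regular) if both sides of every equation in $E$ are linear (strongly regular). Its clone $K_{(\Phi,E)}$ consists of the terms modulo the smallest equivalence relation that contains $E$ and is closed under grafting (substitution) of terms. A \emph{plain operad} $P$ consists of sets $P_n$ ($n\in\mathbb N$), an identity $1\in P_1$, and compositions $P_n\times P_{k_1}\times\dots\times P_{k_n}\to P_{k_1+\dots+k_n}$, $(p,q_1,\dots,q_n)\mapsto p\circ(q_1,\dots,q_n)$, that are associative and unital. A \emph{finite product operad} is a plain operad $Q$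 with a functorial left action $f\cdot-:Q_n\to Q_m$ of all functions $f:\{1,\dots,n\}\to\{1,\dots,m\}$ such that \[ (f\cdot p)\circ(f_1\cdot p_1,\dots,f_m\cdot p_m)=\bigl(f\circ(f_1,\dots,f_m)\bigr)\cdot\bigl(p\circ(p_{f(1)},\dots,p_{f(n)})\bigr) \] for $p\in Q_n$, $p_i\in Q_{k_i}$ and $f_i:\{1,\dots,k_i\}\to\{1,\dots,j_i\}$ ($1\le i\le m$), where $f\circ(f_1,\dots,f_m):\{1,\dots,\sum_{a=1}^n k_{f(a)}\}\to\{1,\dots,\sum_{i=1}^m j_i\}$ sends the $h$-th element of the $a$-th block to the $f_{f(a)}(h)$-th element of the $f(a)$-th block. A \emph{symmetric operad} is defined in the same way, with an action of bijections only. Morphisms preserve all the structure. The \emph{clone} $K_Q$ of a finite product operad $Q$ has the operations of $Q$, the projections $\delta^i_n=(1\mapsto i)\cdot 1\in Q_n$, and the composition $p\bullet(q_1,\dots,q_n)=f\cdot(p\circ(q_1,\dots,q_n))$ for $p\in Q_n$ and $q_1,\dots,q_n\in Q_m$, where $f:\{1,\dots,nm\}\to\{1,\dots,m\}$ is reduction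 modulo $m$. The finite product operad $Q$ is called \emph{strongly regular} (respectively \emph{linear}) if $K_Q\cong K_{(\Phi,E)}$ for some strongly regular (respectively linear) presentation $(\Phi,E)$. \textbf{Theorem.} The forgetful functors from finite product operads to plain operads and to symmetric operads have left adjoints $F^{\mathrm{pl}}_{\mathrm{fp}}$ and $F^{\Sigma}_{\mathrm{fp}}$ respectively, and for every finite product operad $Q$: \begin{enumerate} \item $Q$ is strongly regular if and only if there is a plain operad $P$ with $Q\cong F^{\mathrm{pl}}_{\mathrm{fp}}P$; \item $Q$ is linear if and only if there is a symmetric operad $P$ with $Q\cong F^{\Sigma}_{\mathrm{fp}}P$. \end{enumerate} -/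

import Mathlib

open CategoryTheory

universe u

namespace UA

/-! ## Terms, equations, presentations -/

/-- A signature: a sequence of sets `Φ 0, Φ 1, …`. -/
abbrev Signature : Type (u + 1) := ℕ → Type u

/-- `n`-ary `Φ`-terms. The variables `x_1, …, x_n` are indexed by `Fin n`. -/
inductive Term (Φ : Signature.{u}) (n : ℕ) : Type u
  | var (i : Fin n) : Term Φ n
  | op {m : ℕ} (φ : Φ m) (ts : Fin m → Term Φ n) : Term Φ n

namespace Term

variable {Φ : Signature.{u}}

/-- The sequence of variables of a term, read from left to right. -/
def vars {n : ℕ} : Term Φ n → List (Fin n)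
  | var i => [i]
  | op _ ts => (List.ofFn fun i => (ts i).vars).flatten

/-- The labelling function of a term: it sends `j` to the index of the `j`-th variable
occurring in the term. -/
def label {n : ℕ} (t : Term Φ n) : Fin t.vars.length → Fin n := t.vars.get

/-- A term is linear if its labelling function is a bijection. -/
def IsLinear {n : ℕ} (t : Term Φ n) : Prop := Function.Bijective t.label

/-- A term is strongly regular if its labelling function is an identity. -/
def IsStronglyRegular {n : ℕ} (t : Term Φ n) : Prop :=
  ∃ h : t.vars.length = n, t.label = Fin.cast h

/-- Grafting (simultaneous substitution) of terms. -/
def graft {n m : ℕ} : Term Φ n → (Fin n → Term Φ m) → Term Φ m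
  | var i, us => us i
  | op φ ts, us => op φ fun j => (ts j).graft us

theorem graft_graft {n m p : ℕ} (t : Term Φ n) (us : Fin n → Term Φ m)
    (vs : Fin m → Term Φ p) :
    (t.graft us).graft vs = t.graft fun i => (us i).graft vs := by
  induction t with
  | var i => rfl
  | op φ ts ih => simp only [graft, ih]

theorem graft_var {n : ℕ} (t : Term Φ n) : t.graft var = t := by
  induction t with
  | var i => rfl
  | op φ ts ih => simp only [graft, ih]

end Term

/-- A presentation of a one-sorted algebraic theory: a signature together with a set of
equations; `eqns n` is the set of those equations that are between `n`-ary terms. -/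
structure Presentation where
  /-- The generating operations. -/
  sig : Signature.{u}
  /-- The equations. -/
  eqns : ∀ n : ℕ, Set (Term sig n × Term sig n)

namespace Presentation

/-- Every equation is between linear terms. -/
def IsLinear (E : Presentation.{u}) : Prop :=
  ∀ (n : ℕ), ∀ e ∈ E.eqns n, e.1.IsLinear ∧ e.2.IsLinear

/-- Every equation is between strongly regular terms. -/
def IsStronglyRegular (E : Presentation.{u}) : Prop :=
  ∀ (n : ℕ), ∀ e ∈ E.eqns n, e.1.IsStronglyRegular ∧ e.2.IsStronglyRegular

/-- The closure of the set of equations: the smallest equivalence relation on terms which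
contains the equations and is closed under grafting of terms. -/
inductive Closure (E : Presentation.{u}) : ∀ {n : ℕ}, Term E.sig n → Term E.sig n → Prop
  | of {n : ℕ} {s t : Term E.sig n} (h : (s, t) ∈ E.eqns n) : Closure E s t
  | refl {n : ℕ} (t : Term E.sig n) : Closure E t t
  | symm {n : ℕ} {s t : Term E.sig n} (h : Closure E s t) : Closure E t s
  | trans {n : ℕ} {s t r : Term E.sig n} (h : Closure E s t) (h' : Closure E t r) :
      Closure E s r
  | graft_left {n m : ℕ} {s t : Term E.sig n} (us : Fin n → Term E.sig m)
      (h : Closure E s t) : Closure E (s.graft us) (t.graft us)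
  | graft_right {n m : ℕ} (t : Term E.sig n) {us vs : Fin n → Term E.sig m}
      (h : ∀ i, Closure E (us i) (vs i)) : Closure E (t.graft us) (t.graft vs)

/-- The closure as a setoid on `n`-ary terms. -/
def closureSetoid (E : Presentation.{u}) (n : ℕ) : Setoid (Term E.sig n) where
  r := E.Closure
  iseqv := ⟨.refl, .symm, .trans⟩

end Presentation

/-! ## Clones -/

/-- A clone. -/
structure Clone where
  /-- The `n`-ary operations. -/
  Op : ℕ → Type u
  /-- Composition `f • (g_1, …, g_n)`. -/
  comp {n m : ℕ} (f : Op n) (g : Fin n → Op m) : Op m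
  /-- The projections. -/
  proj {n : ℕ} (i : Fin n) : Op n
  comp_assoc {n m p : ℕ} (f : Op n) (g : Fin n → Op m) (h : Fin m → Op p) :
    comp f (fun i => comp (g i) h) = comp (comp f g) h
  proj_comp {n m : ℕ} (i : Fin n) (f : Fin n → Op m) : comp (proj i) f = f i
  comp_proj {n : ℕ} (f : Op n) : comp f proj = f

namespace Clone

/-- Morphisms of clones. -/
@[ext]
structure Hom (K L : Clone.{u}) where
  /-- The underlying map of signatures. -/
  map {n : ℕ} : K.Op n → L.Op n
  map_comp {n m : ℕ} (f : K.Op n) (g : Fin n → K.Op m) :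
    map (K.comp f g) = L.comp (map f) fun i => map (g i)
  map_proj {n : ℕ} (i : Fin n) : map (K.proj i) = L.proj i

instance : Category.{u} Clone.{u} where
  Hom := Hom
  id _ := { map := fun x => x, map_comp := fun _ _ => rfl, map_proj := fun _ => rfl }
  comp F G :=
    { map := fun x => G.map (F.map x)
      map_comp := fun f g => by rw [F.map_comp, G.map_comp]
      map_proj := fun i => by rw [F.map_proj, G.map_proj] }

end Clone

namespace Presentation

/-- Composition in the clone of a presentation, induced by grafting on representatives. -/
noncomputable def cloneComp (E : Presentation.{u}) {n m : ℕ}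
    (f : Quotient (E.closureSetoid n)) (g : Fin n → Quotient (E.closureSetoid m)) :
    Quotient (E.closureSetoid m) :=
  Quotient.map (fun t => t.graft fun i => (g i).out) (fun _ _ h => Closure.graft_left _ h) f

theorem cloneComp_mk (E : Presentation.{u}) {n m : ℕ} (t : Term E.sig n)
    (us : Fin n → Term E.sig m) :
    E.cloneComp (Quotient.mk (E.closureSetoid n) t)
        (fun i => Quotient.mk (E.closureSetoid m) (us i)) =
      Quotient.mk (E.closureSetoid m) (t.graft us) :=
  Quotient.sound (.graft_right t fun i => Quotient.mk_out (s := E.closureSetoid m) (us i))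

/-- The clone presented by `(Φ, E)`: terms modulo the closure of `E`. -/
noncomputable def clone (E : Presentation.{u}) : Clone.{u} where
  Op n := Quotient (E.closureSetoid n)
  comp := E.cloneComp
  proj i := Quotient.mk _ (.var i)
  comp_assoc {n m p} f g h := by
    obtain ⟨t, rfl⟩ := Quotient.exists_rep f
    choose us hus using fun i => Quotient.exists_rep (g i)
    choose vs hvs using fun i => Quotient.exists_rep (h i)
    obtain rfl : _ = g := funext hus
    obtain rfl : _ = h := funext hvs
    simp only [cloneComp_mk, Term.graft_graft]
  proj_comp {n m} i f := by
    choose us hus using fun i => Quotient.exists_rep (f i)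
    obtain rfl : _ = f := funext hus
    simp only [cloneComp_mk, Term.graft]
  comp_proj {n} f := by
    obtain ⟨t, rfl⟩ := Quotient.exists_rep f
    simp only [cloneComp_mk, Term.graft_var]

end Presentation

namespace Clone

/-- A clone is strongly regular if it has a strongly regular presentation. -/
def IsStronglyRegular (K : Clone.{u}) : Prop :=
  ∃ E : Presentation.{u}, E.IsStronglyRegular ∧ Nonempty (K ≅ E.clone)

/-- A clone is linear if it has a linear presentation. -/
def IsLinear (K : Clone.{u}) : Prop :=
  ∃ E : Presentation.{u}, E.IsLinear ∧ Nonempty (K ≅ E.clone)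

end Clone

/-! ## Plain operads -/

/-- A plain operad. The inputs of `comp p q` are numbered block by block; the input `j` of the
`i`-th block has number `finSigmaFinEquiv ⟨i, j⟩`. The two sides of each axiom have arities that
are equal but not syntactically so, whence the heterogeneous equalities. -/
structure PlainOperad where
  /-- The `n`-ary operations. -/
  Op : ℕ → Type u
  /-- The identity. -/
  one : Op 1
  /-- Composition `p ∘ (q_1, …, q_n)`. -/
  comp {n : ℕ} {k : Fin n → ℕ} (p : Op n) (q : ∀ i, Op (k i)) : Op (∑ i, k i)
  one_comp {n : ℕ} (p : Op n) : HEq (comp (k := fun _ : Fin 1 => n) one fun _ => p) p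
  comp_one {n : ℕ} (p : Op n) : HEq (comp (k := fun _ : Fin n => 1) p fun _ => one) p
  comp_assoc {n : ℕ} {k : Fin n → ℕ} {l : ∀ i, Fin (k i) → ℕ} (f : Op n)
    (g : ∀ i, Op (k i)) (h : ∀ i j, Op (l i j)) :
    HEq (comp f fun i => comp (g i) (h i))
      (comp (comp f g) fun x : Fin (∑ i, k i) =>
        h (finSigmaFinEquiv.symm x).1 (finSigmaFinEquiv.symm x).2)

namespace PlainOperad

/-- Morphisms of plain operads. -/
@[ext]
structure Hom (P Q : PlainOperad.{u}) where
  /-- The underlying map of signatures. -/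
  map {n : ℕ} : P.Op n → Q.Op n
  map_one : map P.one = Q.one
  map_comp {n : ℕ} {k : Fin n → ℕ} (p : P.Op n) (q : ∀ i, P.Op (k i)) :
    map (P.comp p q) = Q.comp (map p) fun i => map (q i)

instance : Category.{u} PlainOperad.{u} where
  Hom := Hom
  id _ := { map := fun x => x, map_one := rfl, map_comp := fun _ _ => rfl }
  comp F G :=
    { map := fun x => G.map (F.map x)
      map_one := by rw [F.map_one, G.map_one]
      map_comp := fun p q => by rw [F.map_comp, G.map_comp] }

end PlainOperad

/-! ## Symmetric operads -/

/-- The function `f ∘ (g_1, …, g_m)`: for `f : [n] → [m]` and `g_i : [k_i] → [j_i]`, it sends the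
input `h` of the `a`-th block (which has size `k_{f(a)}`) to the input `g_{f(a)}(h)` of the
`f(a)`-th block. -/
def blockMap {n m : ℕ} {k j : Fin m → ℕ} (f : Fin n → Fin m)
    (g : ∀ i, Fin (k i) → Fin (j i)) : Fin (∑ a, k (f a)) → Fin (∑ i, j i) :=
  fun x => finSigmaFinEquiv
    ⟨f (finSigmaFinEquiv.symm x).1,
      g (f (finSigmaFinEquiv.symm x).1) (finSigmaFinEquiv.symm x).2⟩

/-- The block permutation: `blockMap` for bijections. -/
def blockEquiv {n m : ℕ} {k j : Fin m → ℕ} (σ : Fin n ≃ Fin m)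
    (τ : ∀ i, Fin (k i) ≃ Fin (j i)) : Fin (∑ a, k (σ a)) ≃ Fin (∑ i, j i) :=
  finSigmaFinEquiv.symm.trans ((Equiv.sigmaCongr σ fun a => τ (σ a)).trans finSigmaFinEquiv)

theorem coe_blockEquiv {n m : ℕ} {k j : Fin m → ℕ} (σ : Fin n ≃ Fin m)
    (τ : ∀ i, Fin (k i) ≃ Fin (j i)) :
    ⇑(blockEquiv σ τ) = blockMap (k := k) (j := j) σ fun i => τ i := rfl

/-- A symmetric operad: a plain operad with compatible left actions of the symmetric groups.
A bijection `Fin n ≃ Fin m` exists only if `n = m`, so that `act` is the same thing as an action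
of `S_n` on `Op n` for each `n`; letting `m` and `n` differ syntactically avoids casts. -/
structure SymmOperad extends PlainOperad.{u} where
  /-- The action of permutations. -/
  act {n m : ℕ} (σ : Fin n ≃ Fin m) (p : Op n) : Op m
  act_refl {n : ℕ} (p : Op n) : act (Equiv.refl _) p = p
  act_act {n m l : ℕ} (ρ : Fin m ≃ Fin l) (σ : Fin n ≃ Fin m) (p : Op n) :
    act ρ (act σ p) = act (σ.trans ρ) p
  act_comp_act {n m : ℕ} {k j : Fin m → ℕ} (σ : Fin n ≃ Fin m)
    (τ : ∀ i, Fin (k i) ≃ Fin (j i)) (p : Op n) (q : ∀ i, Op (k i)) :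
    comp (act σ p) (fun i => act (τ i) (q i)) =
      act (blockEquiv σ τ) (comp p fun a => q (σ a))

namespace SymmOperad

/-- Morphisms of symmetric operads. -/
@[ext]
structure Hom (P Q : SymmOperad.{u}) extends
    PlainOperad.Hom P.toPlainOperad Q.toPlainOperad where
  map_act {n m : ℕ} (σ : Fin n ≃ Fin m) (p : P.Op n) : map (P.act σ p) = Q.act σ (map p)

instance : Category.{u} SymmOperad.{u} where
  Hom := Hom
  id _ :=
    { map := fun x => x, map_one := rfl, map_comp := fun _ _ => rfl, map_act := fun _ _ => rfl }
  comp F G :=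
    { map := fun x => G.map (F.map x)
      map_one := by rw [F.map_one, G.map_one]
      map_comp := fun p q => by rw [F.map_comp, G.map_comp]
      map_act := fun σ p => by rw [F.map_act, G.map_act] }

end SymmOperad

/-! ## Finite product operads -/

/-- A finite product operad: a plain operad with a compatible functorial action of all functions
between the finite sets `Fin n`. -/
structure FPOperad extends PlainOperad.{u} where
  /-- The action of functions. -/
  act {n m : ℕ} (f : Fin n → Fin m) (p : Op n) : Op m
  act_id {n : ℕ} (p : Op n) : act id p = p
  act_act {n m l : ℕ} (f : Fin m → Fin l) (g : Fin n → Fin m) (p : Op n) :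
    act f (act g p) = act (f ∘ g) p
  act_comp_act {n m : ℕ} {k j : Fin m → ℕ} (f : Fin n → Fin m)
    (g : ∀ i, Fin (k i) → Fin (j i)) (p : Op n) (q : ∀ i, Op (k i)) :
    comp (act f p) (fun i => act (g i) (q i)) =
      act (blockMap f g) (comp p fun a => q (f a))

namespace FPOperad

/-- Morphisms of finite product operads. -/
@[ext]
structure Hom (P Q : FPOperad.{u}) extends
    PlainOperad.Hom P.toPlainOperad Q.toPlainOperad where
  map_act {n m : ℕ} (f : Fin n → Fin m) (p : P.Op n) : map (P.act f p) = Q.act f (map p)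

instance : Category.{u} FPOperad.{u} where
  Hom := Hom
  id _ :=
    { map := fun x => x, map_one := rfl, map_comp := fun _ _ => rfl, map_act := fun _ _ => rfl }
  comp F G :=
    { map := fun x => G.map (F.map x)
      map_one := by rw [F.map_one, G.map_one]
      map_comp := fun p q => by rw [F.map_comp, G.map_comp]
      map_act := fun f p => by rw [F.map_act, G.map_act] }

/-- The symmetric operad underlying a finite product operad: forget the actions of the
non-bijective functions. -/
def toSymmOperad (Q : FPOperad.{u}) : SymmOperad.{u} where
  toPlainOperad := Q.toPlainOperad
  act σ p := Q.act σ p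
  act_refl p := Q.act_id p
  act_act ρ σ p := Q.act_act ρ σ p
  act_comp_act σ τ p q := Q.act_comp_act σ (fun i => τ i) p q

/-- The forgetful functor from finite product operads to symmetric operads. -/
def forgetToSymm : FPOperad.{u} ⥤ SymmOperad.{u} where
  obj Q := Q.toSymmOperad
  map F := { toHom := F.toHom, map_act := fun σ p => F.map_act σ p }

/-- The forgetful functor from finite product operads to plain operads. -/
def forgetToPlain : FPOperad.{u} ⥤ PlainOperad.{u} where
  obj Q := Q.toPlainOperad
  map F := F.toHom

/-! ### The clone of a finite product operad -/

/-- Elements related by a heterogeneous equality differ by the action of the identity function,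
regarded as a function between syntactically different sets. -/
theorem act_cast_of_heq (Q : FPOperad.{u}) {a b : ℕ} (h : a = b) {x : Q.Op a} {y : Q.Op b}
    (hxy : HEq x y) : x = Q.act (Fin.cast h.symm) y := by
  subst h
  obtain rfl := eq_of_heq hxy
  exact (Q.act_id x).symm

/-- The position of an input inside its block, for `n` blocks of size `m`: the function
`[nm] → [m]` that sends `x` to `x` modulo `m`. -/
def inBlock (n m : ℕ) (x : Fin (∑ _i : Fin n, m)) : Fin m := (finSigmaFinEquiv.symm x).2

/-- Clone composition in a finite product operad. -/
def cloneComp (Q : FPOperad.{u}) {n m : ℕ} (p : Q.Op n) (q : Fin n → Q.Op m) : Q.Op m :=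
  Q.act (inBlock n m) (Q.comp p q)

/-- The projections in a finite product operad. -/
def cloneProj (Q : FPOperad.{u}) {n : ℕ} (i : Fin n) : Q.Op n := Q.act (fun _ : Fin 1 => i) Q.one

theorem comp_act (Q : FPOperad.{u}) {n : ℕ} {k j : Fin n → ℕ} (g : ∀ i, Fin (k i) → Fin (j i))
    (p : Q.Op n) (q : ∀ i, Q.Op (k i)) :
    Q.comp p (fun i => Q.act (g i) (q i)) =
      Q.act (blockMap (k := k) (j := j) id g) (Q.comp p q) := by
  have h := Q.act_comp_act id g p q
  rwa [Q.act_id] at h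

theorem act_comp (Q : FPOperad.{u}) {n m : ℕ} {k : Fin m → ℕ} (f : Fin n → Fin m)
    (p : Q.Op n) (q : ∀ i, Q.Op (k i)) :
    Q.comp (Q.act f p) q =
      Q.act (blockMap (k := k) (j := k) f fun _ => id) (Q.comp p fun a => q (f a)) := by
  have h := Q.act_comp_act (k := k) (j := k) f (fun _ => id) p q
  simpa only [Q.act_id] using h

theorem inBlock_blockMap {n m p : ℕ} {k : Fin m → ℕ} (f : Fin n → Fin m)
    (g : ∀ i, Fin (k i) → Fin p) (x : Fin (∑ a, k (f a))) :
    inBlock m p (blockMap (k := k) (j := fun _ => p) f g x) =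
      g (f (finSigmaFinEquiv.symm x).1) (finSigmaFinEquiv.symm x).2 := by
  simp only [inBlock, blockMap, Equiv.symm_apply_apply]

theorem cloneProj_comp (Q : FPOperad.{u}) {n m : ℕ} (i : Fin n) (f : Fin n → Q.Op m) :
    Q.cloneComp (Q.cloneProj i) f = f i := by
  have e : ∑ _a : Fin 1, m = m := by simp
  rw [cloneComp, cloneProj, act_comp, Q.act_cast_of_heq e (Q.one_comp (f i)), Q.act_act,
    Q.act_act]
  conv_rhs => rw [← Q.act_id (f i)]
  congr 1
  funext x
  obtain ⟨y, rfl⟩ : ∃ y, x = Fin.cast e y := ⟨Fin.cast e.symm x, rfl⟩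
  obtain ⟨⟨a, b⟩, rfl⟩ := finSigmaFinEquiv.surjective y
  simp only [Function.comp, inBlock_blockMap]
  obtain rfl := Subsingleton.elim a 0
  ext
  simp [finSigmaFinEquiv_apply]

theorem cloneComp_proj (Q : FPOperad.{u}) {n : ℕ} (f : Q.Op n) :
    Q.cloneComp f Q.cloneProj = f := by
  have e : ∑ _a : Fin n, 1 = n := by simp
  have h : Q.comp f (k := fun _ => n) (fun i => Q.cloneProj i) = _ :=
    Q.comp_act (k := fun _ => 1) (j := fun _ => n) (fun i _ => i) f (fun _ => Q.one)
  rw [cloneComp, h, Q.act_cast_of_heq e (Q.comp_one f), Q.act_act, Q.act_act]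
  conv_rhs => rw [← Q.act_id f]
  congr 1
  funext x
  obtain ⟨y, rfl⟩ : ∃ y, x = Fin.cast e y := ⟨Fin.cast e.symm x, rfl⟩
  obtain ⟨⟨a, b⟩, rfl⟩ := finSigmaFinEquiv.surjective y
  simp only [Function.comp, inBlock_blockMap]
  obtain rfl := Subsingleton.elim b 0
  ext
  simp [finSigmaFinEquiv_apply]

theorem cloneComp_assoc (Q : FPOperad.{u}) {n m p : ℕ} (f : Q.Op n) (g : Fin n → Q.Op m)
    (h : Fin m → Q.Op p) :
    Q.cloneComp f (fun i => Q.cloneComp (g i) h) = Q.cloneComp (Q.cloneComp f g) h := by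
  have e : ∑ _i : Fin n, ∑ _j : Fin m, p = ∑ _x : Fin (∑ _i : Fin n, m), p := by
    simp [mul_assoc]
  have h₁ : Q.comp f (k := fun _ => p) (fun i => Q.cloneComp (g i) h) = _ :=
    Q.comp_act (k := fun _ => ∑ _j : Fin m, p) (j := fun _ => p) (fun _ => inBlock m p) f
      (fun i => Q.comp (g i) h)
  have h₂ : Q.comp (Q.cloneComp f g) h = _ := Q.act_comp (inBlock n m) (Q.comp f g) h
  rw [cloneComp, h₁, cloneComp, h₂,
    Q.act_cast_of_heq e (Q.comp_assoc f g (fun _ j => h j)), Q.act_act, Q.act_act, Q.act_act]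
  refine congrFun (congrArg Q.act (funext fun x => ?_)) _
  obtain ⟨y, rfl⟩ : ∃ y, x = Fin.cast e y := ⟨Fin.cast e.symm x, rfl⟩
  obtain ⟨⟨a, y'⟩, rfl⟩ := finSigmaFinEquiv.surjective y
  obtain ⟨⟨b, c⟩, rfl⟩ := finSigmaFinEquiv.surjective y'
  have key : Fin.cast e (finSigmaFinEquiv ⟨a, finSigmaFinEquiv ⟨b, c⟩⟩) =
      finSigmaFinEquiv (n := fun _ => p)
        ⟨finSigmaFinEquiv (n := fun _ : Fin n => m) ⟨a, b⟩, c⟩ := by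
    ext
    simp [finSigmaFinEquiv_apply]
    ring
  simp only [Function.comp, Fin.cast_cast, Fin.cast_eq_self, inBlock_blockMap,
    Equiv.symm_apply_apply]
  rw [key]
  simp [inBlock]

/-- The clone of a finite product operad: it has the same operations, and
`p • (q_1, …, q_n) = f · (p ∘ (q_1, …, q_n))` where `f : [nm] → [m]` is reduction modulo `m`. -/
def clone (Q : FPOperad.{u}) : Clone.{u} where
  Op := Q.Op
  comp := Q.cloneComp
  proj := Q.cloneProj
  comp_assoc := Q.cloneComp_assoc
  proj_comp := Q.cloneProj_comp
  comp_proj := Q.cloneComp_proj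

/-- A finite product operad is strongly regular if its clone is. -/
def IsStronglyRegular (Q : FPOperad.{u}) : Prop := Q.clone.IsStronglyRegular

/-- A finite product operad is linear if its clone is. -/
def IsLinear (Q : FPOperad.{u}) : Prop := Q.clone.IsLinear

end FPOperad

end UA

namespace UA

/-! Finite product operads and clones carry the same information: `act`, `comp` and `one` are
expressible through clone composition and projections (`act_eq_cloneComp`, `comp_eq_cloneComp`), and
conversely a clone yields a finite product operad (`Clone.toFP`). So a presentation `E` presents a
finite product operad `E.fp`, with the expected universal property (`Presentation.lift`, `hom_ext`).

The free finite product operad on a plain or symmetric operad `P` is presented by taking all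
operations of `P` as symbols and all identities of `P` as equations. These equations are strongly
regular, respectively linear, so free objects have presentations of the required kind.

Conversely, let `E` be strongly regular, and let `P` consist of the classes in `E.fp` of strongly
regular terms; it is closed under operadic composition. The inclusion of `P` induces a map `F P →
E.fp`. For an inverse, send a symbol to the image of its class under the unit `η : P → F P`. The
equations hold in `F P` because a strongly regular term evaluates there to `η` of its own class, and
the two sides of an equation have the same class. This is proved by induction for all terms at once:
each term is a relabelling `f` of a strongly regular term `t'`, and its value is `f · η[t']`
(`exists_regular_eval_eq`). For a strongly regular term `f` is the identity; for a linear one it is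
a bijection, which a morphism of symmetric operads respects. -/

/-! ## Blocks of inputs -/

/-- The inclusion of the `i`-th block. -/
def blockIncl {n : ℕ} (k : Fin n → ℕ) (i : Fin n) (j : Fin (k i)) : Fin (∑ i, k i) :=
  finSigmaFinEquiv ⟨i, j⟩

theorem blockIncl_surjective {n : ℕ} {k : Fin n → ℕ} (x : Fin (∑ i, k i)) :
    ∃ i j, x = blockIncl k i j :=
  ⟨(finSigmaFinEquiv.symm x).1, (finSigmaFinEquiv.symm x).2, by simp [blockIncl]⟩

theorem blockIncl_injective {n : ℕ} (k : Fin n → ℕ) (i : Fin n) :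
    Function.Injective (blockIncl k i) := fun a b h => by
  simpa [blockIncl] using h

/-- Offsets as partial sums over `Finset.range` make different blocks comparable. The default `0` is
never reached, since `a < i < n`. -/
theorem val_blockIncl {n : ℕ} (k : Fin n → ℕ) (i : Fin n) (j : Fin (k i)) :
    (blockIncl k i j : ℕ) =
      ∑ a ∈ Finset.range i, (if h : a < n then k ⟨a, h⟩ else 0) + j := by
  rw [blockIncl, finSigmaFinEquiv_apply, ← Fin.sum_univ_eq_sum_range]
  congr 1
  refine Finset.sum_congr rfl fun a _ => ?_
  rw [dif_pos (a.2.trans i.2)]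
  rfl

theorem blockIncl_lt_of_lt {n : ℕ} (k : Fin n → ℕ) {i i' : Fin n} (h : i < i')
    (j : Fin (k i)) (j' : Fin (k i')) : blockIncl k i j < blockIncl k i' j' := by
  rw [Fin.lt_def, val_blockIncl, val_blockIncl]
  have h₁ : ∑ a ∈ Finset.range (i + 1), (if h : a < n then k ⟨a, h⟩ else 0) ≤
      ∑ a ∈ Finset.range i', (if h : a < n then k ⟨a, h⟩ else 0) :=
    Finset.sum_le_sum_of_subset (Finset.range_mono h)
  rw [Finset.sum_range_succ, dif_pos i.2] at h₁
  have h₂ := j.2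
  simp only [Fin.eta] at h₁
  omega

theorem blockIncl_strictMono {n : ℕ} (k : Fin n → ℕ) (i : Fin n) :
    StrictMono (blockIncl k i) := fun a b h => by
  rw [Fin.lt_def, val_blockIncl, val_blockIncl]
  exact Nat.add_lt_add_left h _

theorem blockMap_blockIncl {n m : ℕ} {k j : Fin m → ℕ} (f : Fin n → Fin m)
    (g : ∀ i, Fin (k i) → Fin (j i)) (a : Fin n) (b : Fin (k (f a))) :
    blockMap f g (blockIncl (fun a => k (f a)) a b) = blockIncl j (f a) (g (f a) b) := by
  -- The type of the second component depends on the first, so the pair is replaced as a whole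
  -- rather than rewritten.
  have key : ∀ y : (a : Fin n) × Fin (k (f a)), y = ⟨a, b⟩ →
      finSigmaFinEquiv (n := j) ⟨f y.1, g (f y.1) y.2⟩ = blockIncl j (f a) (g (f a) b) := by
    rintro _ rfl
    rfl
  exact key _ (Equiv.symm_apply_apply _ _)

/-- Monotonicity alone identifies a reindexing, with no computation of positions. -/
theorem strictMono_eq_cast {n m : ℕ} (h : n = m) {f : Fin n → Fin m} (hf : StrictMono f) :
    f = Fin.cast h := by
  subst h
  exact hf.eq_id

theorem sum_sum_blocks {n : ℕ} (k : Fin n → ℕ) (l : ∀ i, Fin (k i) → ℕ) :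
    ∑ i, ∑ j, l i j =
      ∑ x : Fin (∑ i, k i), l (finSigmaFinEquiv.symm x).1 (finSigmaFinEquiv.symm x).2 :=
  (Finset.sum_sigma' Finset.univ (fun _ => Finset.univ) l).trans
    (Equiv.sum_comp finSigmaFinEquiv.symm
      fun x : (i : Fin n) × Fin (k i) => l x.1 x.2).symm

/-- Reindexing a double family of blocks by its inner blocks. -/
def blockAssoc {n : ℕ} (k : Fin n → ℕ) (l : ∀ i, Fin (k i) → ℕ) :
    ((i : Fin n) × (j : Fin (k i)) × Fin (l i j)) →
      Fin (∑ x : Fin (∑ i, k i), l (finSigmaFinEquiv.symm x).1 (finSigmaFinEquiv.symm x).2) :=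
  fun x => blockIncl _ (blockIncl k x.1 x.2.1)
    (Fin.cast (by rw [blockIncl, Equiv.symm_apply_apply]) x.2.2)

/-- Both nestings of blocks list the triples `(i, j, c)` lexicographically. Hence the map `F` from
one numbering to the other is strictly increasing, and it must be the cast. -/
theorem cast_blockIncl_blockIncl {n : ℕ} (k : Fin n → ℕ) (l : ∀ i, Fin (k i) → ℕ)
    (i : Fin n) (j : Fin (k i)) (c : Fin (l i j)) :
    Fin.cast (sum_sum_blocks k l) (blockIncl (fun i => ∑ j, l i j) i (blockIncl (l i) j c)) =
      blockAssoc k l ⟨i, j, c⟩ := by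
  let G : ((i : Fin n) × Fin (∑ j, l i j)) → _ := fun x =>
    blockAssoc k l ⟨x.1, finSigmaFinEquiv.symm x.2⟩
  let F : Fin (∑ i, ∑ j, l i j) → _ := fun x => G (finSigmaFinEquiv.symm x)
  have hF : ∀ i j c, F (blockIncl (fun i => ∑ j, l i j) i (blockIncl (l i) j c)) =
      blockAssoc k l ⟨i, j, c⟩ := fun i j c =>
    (congrArg G (Equiv.symm_apply_apply _ _)).trans
      (congrArg (fun y => blockAssoc k l ⟨i, y⟩) (Equiv.symm_apply_apply _ _))
  have hmono : StrictMono F := by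
    intro x y hxy
    obtain ⟨i, x', rfl⟩ := blockIncl_surjective x
    obtain ⟨i', y', rfl⟩ := blockIncl_surjective y
    obtain ⟨j, c, rfl⟩ := blockIncl_surjective x'
    obtain ⟨j', c', rfl⟩ := blockIncl_surjective y'
    rw [hF, hF]
    rcases lt_trichotomy i i' with h | rfl | h
    · exact blockIncl_lt_of_lt _ (blockIncl_lt_of_lt _ h _ _) _ _
    · rw [(blockIncl_strictMono _ _).lt_iff_lt] at hxy
      rcases lt_trichotomy j j' with h | rfl | h
      · exact blockIncl_lt_of_lt _ (blockIncl_strictMono _ _ h) _ _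
      · rw [(blockIncl_strictMono _ _).lt_iff_lt] at hxy
        exact blockIncl_strictMono _ _ hxy
      · exact absurd (blockIncl_lt_of_lt _ h c' c) hxy.asymm
    · exact absurd (blockIncl_lt_of_lt (fun i => ∑ j, l i j) h (blockIncl (l i') j' c')
        (blockIncl (l i) j c)) hxy.asymm
  rw [← strictMono_eq_cast (sum_sum_blocks k l) hmono, hF]

theorem blockIncl_one {n : ℕ} (e : ∑ _i : Fin 1, n = n) (j : Fin n) :
    Fin.cast e (blockIncl (fun _ : Fin 1 => n) 0 j) = j := by
  ext; simp [blockIncl, finSigmaFinEquiv_apply]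

theorem blockIncl_ones {n : ℕ} (e : ∑ _i : Fin n, 1 = n) (i : Fin n) (j : Fin 1) :
    Fin.cast e (blockIncl (fun _ : Fin n => 1) i j) = i := by
  obtain rfl := Subsingleton.elim j 0
  ext; simp [blockIncl, finSigmaFinEquiv_apply]

/-- Both lists are strictly increasing and contain every input. This is the combinatorial reason why
strongly regular terms are closed under operadic composition. -/
theorem flatMap_blockIncl {n : ℕ} (k : Fin n → ℕ) :
    ((List.finRange n).flatMap fun i => (List.finRange (k i)).map (blockIncl k i)) =
      List.finRange (∑ i, k i) := by
  have h : ((List.finRange n).flatMap fun i =>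
      (List.finRange (k i)).map (blockIncl k i)).SortedLT := by
    rw [List.sortedLT_iff_pairwise, List.pairwise_flatMap]
    refine ⟨fun i _ => ?_, ?_⟩
    · rw [List.pairwise_map]
      exact (List.pairwise_lt_finRange _).imp fun h => blockIncl_strictMono k i h
    · refine (List.pairwise_lt_finRange _).imp fun {i i'} h x hx y hy => ?_
      obtain ⟨j, -, rfl⟩ := List.mem_map.1 hx
      obtain ⟨j', -, rfl⟩ := List.mem_map.1 hy
      exact blockIncl_lt_of_lt k h j j'
  refine h.eq_of_mem_iff (List.sortedLT_finRange _) fun x => ?_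
  obtain ⟨i, j, rfl⟩ := blockIncl_surjective x
  simp only [List.mem_flatMap, List.mem_map, List.mem_finRange, true_and, iff_true]
  exact ⟨i, j, rfl⟩

/-! ## Finite product operads in terms of their clones -/

namespace FPOperad

variable (Q : FPOperad.{u})

theorem act_cloneComp {n m l : ℕ} (f : Fin m → Fin l) (p : Q.Op n) (q : Fin n → Q.Op m) :
    Q.act f (Q.cloneComp p q) = Q.cloneComp p fun i => Q.act f (q i) := by
  have h : Q.comp p (k := fun _ => l) (fun i => Q.act f (q i)) = _ :=
    Q.comp_act (k := fun _ => m) (j := fun _ => l) (fun _ => f) p q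
  rw [cloneComp, cloneComp, h, Q.act_act, Q.act_act]
  refine congrFun (congrArg Q.act (funext fun x => ?_)) _
  simp only [Function.comp, inBlock_blockMap]
  rfl

theorem act_cloneProj {n m : ℕ} (f : Fin n → Fin m) (i : Fin n) :
    Q.act f (Q.cloneProj i) = Q.cloneProj (f i) := by
  rw [cloneProj, Q.act_act]
  rfl

theorem act_eq_cloneComp {n m : ℕ} (f : Fin n → Fin m) (p : Q.Op n) :
    Q.act f p = Q.cloneComp p fun i => Q.cloneProj (f i) := by
  conv_lhs => rw [← Q.cloneComp_proj p, act_cloneComp]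
  simp only [act_cloneProj]

/-- Relabelling the `q i` into disjoint blocks before composing makes `inBlock` undo the block map.
With `act_eq_cloneComp` and `one_eq_cloneProj`, the whole structure is recovered from the clone. -/
theorem comp_eq_cloneComp {n : ℕ} {k : Fin n → ℕ} (p : Q.Op n) (q : ∀ i, Q.Op (k i)) :
    Q.comp p q = Q.cloneComp p fun i => Q.act (blockIncl k i) (q i) := by
  have h : Q.comp p (k := fun _ => ∑ i, k i) (fun i => Q.act (blockIncl k i) (q i)) = _ :=
    Q.comp_act (k := k) (j := fun _ => ∑ i, k i) (blockIncl k) p q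
  rw [cloneComp, h, Q.act_act]
  conv_lhs => rw [← Q.act_id (Q.comp p q)]
  refine congrFun (congrArg Q.act (funext fun x => ?_)) _
  simp [Function.comp, inBlock_blockMap (f := id), blockIncl]

theorem one_eq_cloneProj : Q.one = Q.cloneProj (0 : Fin 1) := by
  rw [cloneProj]
  conv_lhs => rw [← Q.act_id Q.one]
  congr 1
  funext x
  exact Subsingleton.elim _ _

end FPOperad

/-! ## The finite product operad of a clone -/

namespace Clone

variable (K : Clone.{u})

/-- Relabelling of the arguments of an operation of a clone. -/
def act {n m : ℕ} (f : Fin n → Fin m) (p : K.Op n) : K.Op m := K.comp p fun i => K.proj (f i)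

theorem comp_act {n m l : ℕ} (f : Fin n → Fin m) (p : K.Op n) (q : Fin m → K.Op l) :
    K.comp (K.act f p) q = K.comp p fun i => q (f i) := by
  simp only [act, ← K.comp_assoc, K.proj_comp]

theorem act_comp {n m l : ℕ} (f : Fin m → Fin l) (p : K.Op n) (q : Fin n → K.Op m) :
    K.act f (K.comp p q) = K.comp p fun i => K.act f (q i) := by
  simp only [act, K.comp_assoc]

theorem act_proj {n m : ℕ} (f : Fin n → Fin m) (i : Fin n) :
    K.act f (K.proj i) = K.proj (f i) := K.proj_comp _ _

theorem act_act {n m l : ℕ} (f : Fin m → Fin l) (g : Fin n → Fin m) (p : K.Op n) :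
    K.act f (K.act g p) = K.act (f ∘ g) p := by
  rw [act, comp_act]
  rfl

theorem act_id {n : ℕ} (p : K.Op n) : K.act id p = p := K.comp_proj p

/-- Turns the heterogeneous operad axioms into honest equations after a relabelling, which
`act_blockComp` then pushes inwards. -/
theorem heq_of_act_cast {a b : ℕ} (h : a = b) {x : K.Op a} {y : K.Op b}
    (hxy : K.act (Fin.cast h) x = y) : HEq x y := by
  subst h
  subst hxy
  exact heq_of_eq (K.act_id x).symm

/-- Operadic composition in a clone. -/
def blockComp {n : ℕ} {k : Fin n → ℕ} (p : K.Op n) (q : ∀ i, K.Op (k i)) : K.Op (∑ i, k i) :=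
  K.comp p fun i => K.act (blockIncl k i) (q i)

theorem act_blockComp {n m : ℕ} {k : Fin n → ℕ} (f : Fin (∑ i, k i) → Fin m) (p : K.Op n)
    (q : ∀ i, K.Op (k i)) :
    K.act f (K.blockComp p q) = K.comp p fun i => K.act (fun j => f (blockIncl k i j)) (q i) := by
  simp only [blockComp, act_comp, act_act, Function.comp_def]

/-- The finite product operad of a clone. -/
def toFP : FPOperad.{u} where
  Op := K.Op
  one := K.proj 0
  comp := K.blockComp
  act := K.act
  act_id := K.act_id
  act_act := K.act_act
  one_comp {n} p := by
    have e : ∑ _i : Fin 1, n = n := by simp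
    refine K.heq_of_act_cast e ?_
    rw [act_blockComp, K.proj_comp]
    simp only [blockIncl_one]
    exact K.act_id p
  comp_one {n} p := by
    have e : ∑ _i : Fin n, 1 = n := by simp
    refine K.heq_of_act_cast e ?_
    rw [act_blockComp]
    simp only [blockIncl_ones, act_proj, K.comp_proj]
  comp_assoc {n k l} f g h := by
    refine K.heq_of_act_cast (sum_sum_blocks k l) ?_
    rw [act_blockComp]
    have hl (i : Fin n) := K.act_blockComp
      (fun x => Fin.cast (sum_sum_blocks k l) (blockIncl (fun i => ∑ j, l i j) i x)) (g i) (h i)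
    simp only [hl, cast_blockIncl_blockIncl]
    simp only [blockComp, ← K.comp_assoc, comp_act]
    refine congrArg (K.comp f) (funext fun i => congrArg (K.comp (g i)) (funext fun j => ?_))
    -- Both sides now apply `h i j` followed by a block inclusion. On the right the pair `(i, j)`
    -- appears as a decoded position, and the cast in `blockAssoc` is exactly this transport.
    have key : ∀ (y : (i : Fin n) × Fin (k i)) (hy : y = ⟨i, j⟩)
        (B : Fin (l y.1 y.2) →
          Fin (∑ x : Fin (∑ i, k i), l (finSigmaFinEquiv.symm x).1 (finSigmaFinEquiv.symm x).2)),
        K.act B (h y.1 y.2) = K.act (fun c => B (Fin.cast (by rw [hy]) c)) (h i j) := by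
      rintro y rfl B
      rfl
    exact (key (finSigmaFinEquiv.symm (blockIncl k i j)) (Equiv.symm_apply_apply _ _)
      (blockIncl (fun x => l (finSigmaFinEquiv.symm x).1 (finSigmaFinEquiv.symm x).2)
        (blockIncl k i j))).symm
  act_comp_act f g p q := by
    rw [act_blockComp, blockComp, comp_act]
    simp only [act_act, blockMap_blockIncl]
    rfl

theorem toFP_cloneComp {n m : ℕ} (p : K.Op n) (q : Fin n → K.Op m) :
    K.toFP.cloneComp p q = K.comp p q := by
  refine (K.act_blockComp _ p q).trans ?_
  have (i : Fin n) : (fun j => FPOperad.inBlock n m (blockIncl (fun _ => m) i j)) = id := by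
    funext j
    simp [FPOperad.inBlock, blockIncl]
  simp only [this, act_id]

theorem toFP_cloneProj {n : ℕ} (i : Fin n) : K.toFP.cloneProj i = K.proj i :=
  K.act_proj _ _

end Clone

/-! ### Morphisms and isomorphisms of finite product operads versus those of clones. -/

namespace FPOperad

/-- A morphism of finite product operads induces a morphism of clones. -/
def Hom.toClone {Q R : FPOperad.{u}} (F : Hom Q R) : Clone.Hom Q.clone R.clone where
  map x := F.map x
  map_comp f g := by
    change F.map (Q.act _ (Q.comp _ _)) = R.act _ (R.comp _ _)
    exact (F.map_act _ _).trans (congrArg _ (F.map_comp _ _))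
  map_proj i := by
    change F.map (Q.act _ Q.one) = R.act _ R.one
    exact (F.map_act _ _).trans (congrArg _ F.map_one)

/-- A map that preserves clone composition and projections is a morphism of finite product
operads. -/
def homOfMap {Q R : FPOperad.{u}} (F : ∀ {n : ℕ}, Q.Op n → R.Op n)
    (hc : ∀ {n m : ℕ} (f : Q.Op n) (g : Fin n → Q.Op m),
      F (Q.cloneComp f g) = R.cloneComp (F f) fun i => F (g i))
    (hp : ∀ {n : ℕ} (i : Fin n), F (Q.cloneProj i) = R.cloneProj i) : Hom Q R :=
  have ha {n m : ℕ} (f : Fin n → Fin m) (p : Q.Op n) : F (Q.act f p) = R.act f (F p) := by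
    rw [act_eq_cloneComp, hc, act_eq_cloneComp]
    simp only [hp]
  { map := F
    map_one := by rw [one_eq_cloneProj, hp, one_eq_cloneProj]
    map_comp := fun p q => by
      rw [comp_eq_cloneComp, hc, comp_eq_cloneComp]
      simp only [ha]
    map_act := ha }

/-- The morphism of finite product operads given by a morphism between their clones. -/
def homOfClone {Q R : FPOperad.{u}} (F : Clone.Hom Q.clone R.clone) : Hom Q R :=
  homOfMap (fun {n} => F.map (n := n)) F.map_comp F.map_proj

/-- Isomorphic finite product operads have isomorphic clones. -/
def cloneIso {Q R : FPOperad.{u}} (e : Q ≅ R) : Q.clone ≅ R.clone where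
  hom := Hom.toClone e.hom
  inv := Hom.toClone e.inv
  hom_inv_id := Clone.Hom.ext (congrArg (fun F : Hom Q Q => @F.map) e.hom_inv_id)
  inv_hom_id := Clone.Hom.ext (congrArg (fun F : Hom R R => @F.map) e.inv_hom_id)

/-- Finite product operads with isomorphic clones are isomorphic. -/
def isoOfCloneIso {Q R : FPOperad.{u}} (e : Q.clone ≅ R.clone) : Q ≅ R where
  hom := homOfClone e.hom
  inv := homOfClone e.inv
  hom_inv_id := by
    refine Hom.ext ?_
    exact congrArg (fun F : Clone.Hom Q.clone Q.clone => @F.map) e.hom_inv_id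
  inv_hom_id := by
    refine Hom.ext ?_
    exact congrArg (fun F : Clone.Hom R.clone R.clone => @F.map) e.inv_hom_id

end FPOperad

/-- A clone is isomorphic to the clone of its finite product operad. -/
def Clone.toFPCloneIso (K : Clone.{u}) : K.toFP.clone ≅ K where
  hom :=
    { map := fun x => x
      map_comp := K.toFP_cloneComp
      map_proj := K.toFP_cloneProj }
  inv :=
    { map := fun x => x
      map_comp := fun f g => (K.toFP_cloneComp f g).symm
      map_proj := fun i => (K.toFP_cloneProj i).symm }
  hom_inv_id := rfl
  inv_hom_id := rfl

/-! ## Variables of terms -/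

namespace Term

variable {Φ : Signature.{u}}

theorem vars_op {n m : ℕ} (φ : Φ m) (ts : Fin m → Term Φ n) :
    (op φ ts).vars = (List.finRange m).flatMap fun i => (ts i).vars := by
  rw [vars, List.ofFn_eq_map, List.flatMap]

theorem vars_graft {n m : ℕ} (t : Term Φ n) (us : Fin n → Term Φ m) :
    (t.graft us).vars = t.vars.flatMap fun i => (us i).vars := by
  induction t with
  | var i => simp [graft, vars]
  | op φ ts ih => simp only [graft, vars_op, ih, List.flatMap_assoc]

theorem vars_graft_var {n m : ℕ} (t : Term Φ n) (f : Fin n → Fin m) :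
    (t.graft fun i => var (f i)).vars = t.vars.map f := by
  simp only [vars_graft, vars, List.map_eq_flatMap]

theorem vars_op_var {n m : ℕ} (φ : Φ m) (f : Fin m → Fin n) :
    (op φ fun i => var (f i)).vars = (List.finRange m).map f := by
  rw [vars_op, List.map_eq_flatMap]
  rfl

/-- The list form removes the cast along the length, so that concatenation of variable lists can be
used directly. -/
theorem isStronglyRegular_iff {n : ℕ} (t : Term Φ n) :
    t.IsStronglyRegular ↔ t.vars = List.finRange n := by
  rw [IsStronglyRegular, label]
  generalize t.vars = l
  constructor
  · rintro ⟨h, hl⟩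
    refine List.ext_getElem (by simpa using h) fun i h₁ h₂ => ?_
    simpa using congrFun hl ⟨i, h₁⟩
  · rintro rfl
    exact ⟨List.length_finRange, funext fun i => by ext; simp⟩

theorem isLinear_iff {n : ℕ} (t : Term Φ n) :
    t.IsLinear ↔ t.vars.Nodup ∧ ∀ i, i ∈ t.vars := by
  rw [IsLinear, label, Function.Bijective, ← List.nodup_iff_injective_get]
  simp only [Function.Surjective, List.mem_iff_get]

theorem isLinear_of_vars_eq {n : ℕ} {t : Term Φ n} (h : t.vars = List.finRange n) :
    t.IsLinear := by
  rw [isLinear_iff, h]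
  exact ⟨List.nodup_finRange n, List.mem_finRange⟩

theorem IsStronglyRegular.isLinear {n : ℕ} {t : Term Φ n} (h : t.IsStronglyRegular) :
    t.IsLinear := isLinear_of_vars_eq ((isStronglyRegular_iff t).1 h)

/-- The operadic composition of terms: substitution with disjoint blocks of variables. -/
def blockGraft {n : ℕ} {k : Fin n → ℕ} (t : Term Φ n) (us : ∀ i, Term Φ (k i)) :
    Term Φ (∑ i, k i) :=
  t.graft fun i => (us i).graft fun j => var (blockIncl k i j)

theorem vars_blockGraft {n : ℕ} {k : Fin n → ℕ} (t : Term Φ n) (us : ∀ i, Term Φ (k i)) :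
    (t.blockGraft us).vars = t.vars.flatMap fun i => (us i).vars.map (blockIncl k i) := by
  simp only [blockGraft, vars_graft t, vars_graft_var]

theorem IsStronglyRegular.blockGraft {n : ℕ} {k : Fin n → ℕ} {t : Term Φ n}
    {us : ∀ i, Term Φ (k i)} (ht : t.IsStronglyRegular) (hus : ∀ i, (us i).IsStronglyRegular) :
    (t.blockGraft us).IsStronglyRegular := by
  simp only [isStronglyRegular_iff] at *
  simp only [vars_blockGraft, ht, hus, flatMap_blockIncl]

theorem IsLinear.blockGraft {n : ℕ} {k : Fin n → ℕ} {t : Term Φ n}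
    {us : ∀ i, Term Φ (k i)} (ht : t.IsLinear) (hus : ∀ i, (us i).IsLinear) :
    (t.blockGraft us).IsLinear := by
  simp only [isLinear_iff] at *
  rw [vars_blockGraft]
  refine ⟨List.nodup_flatMap.2 ⟨fun i _ => (hus i).1.map (blockIncl_injective k i), ?_⟩,
    fun x => ?_⟩
  · refine ht.1.imp fun {i i'} h => ?_
    simp only [Function.onFun, List.disjoint_left, List.mem_map]
    rintro _ ⟨j, -, rfl⟩ ⟨j', -, hj⟩
    rcases lt_or_gt_of_ne h with h | h
    · exact (blockIncl_lt_of_lt k h j j').ne' hj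
    · exact (blockIncl_lt_of_lt k h j' j).ne hj
  · obtain ⟨i, j, rfl⟩ := blockIncl_surjective x
    simp only [List.mem_flatMap, List.mem_map]
    exact ⟨i, ht.2 i, j, (hus i).2 j, rfl⟩

theorem IsLinear.graft_equiv {n m : ℕ} {t : Term Φ n} (ht : t.IsLinear) (σ : Fin n ≃ Fin m) :
    (t.graft fun i => var (σ i)).IsLinear := by
  rw [isLinear_iff] at *
  rw [vars_graft_var]
  refine ⟨ht.1.map σ.injective, fun i => List.mem_map.2 ⟨σ.symm i, ht.2 _, by simp⟩⟩

/-- Evaluation of terms in a finite product operad. -/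
def eval (Q : FPOperad.{u}) (a : ∀ m : ℕ, Φ m → Q.Op m) {n : ℕ} : Term Φ n → Q.Op n
  | var i => Q.cloneProj i
  | op (m := m) φ ts => Q.cloneComp (a m φ) fun i => (ts i).eval Q a

theorem eval_graft (Q : FPOperad.{u}) (a : ∀ m : ℕ, Φ m → Q.Op m) {n m : ℕ} (t : Term Φ n)
    (us : Fin n → Term Φ m) :
    (t.graft us).eval Q a = Q.cloneComp (t.eval Q a) fun i => (us i).eval Q a := by
  induction t with
  | var i => exact (Q.cloneProj_comp i fun i => (us i).eval Q a).symm
  | op φ ts ih => simp only [graft, eval, ih, Q.cloneComp_assoc]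

theorem eval_op_var (Q : FPOperad.{u}) (a : ∀ m : ℕ, Φ m → Q.Op m) {n m : ℕ} (φ : Φ m)
    (f : Fin m → Fin n) : (op φ fun i => var (f i)).eval Q a = Q.act f (a m φ) := by
  simp only [eval, Q.act_eq_cloneComp]

end Term

/-! ## The finite product operad of a presentation -/

namespace Presentation

variable (E : Presentation.{u})

/-- The finite product operad presented by `E`. -/
noncomputable def fp : FPOperad.{u} := E.clone.toFP

/-- The operation of `E.fp` represented by a term. -/
def cls {n : ℕ} (t : Term E.sig n) : E.fp.Op n := Quotient.mk (E.closureSetoid n) t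

/-- The operation of `E.fp` represented by a symbol of the signature. -/
def gen {n : ℕ} (φ : E.sig n) : E.fp.Op n := E.cls (.op φ .var)

theorem exists_cls_eq {n : ℕ} (x : E.fp.Op n) : ∃ t, E.cls t = x := Quotient.exists_rep x

theorem cloneComp_cls {n m : ℕ} (t : Term E.sig n) (us : Fin n → Term E.sig m) :
    E.fp.cloneComp (E.cls t) (fun i => E.cls (us i)) = E.cls (t.graft us) :=
  (E.clone.toFP_cloneComp _ _).trans (E.cloneComp_mk t us)

theorem cls_var {n : ℕ} (i : Fin n) : E.cls (.var i) = E.fp.cloneProj i :=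
  (E.clone.toFP_cloneProj i).symm

theorem act_cls {n m : ℕ} (f : Fin n → Fin m) (t : Term E.sig n) :
    E.fp.act f (E.cls t) = E.cls (t.graft fun i => .var (f i)) :=
  E.cloneComp_mk t fun i => .var (f i)

theorem comp_cls {n : ℕ} {k : Fin n → ℕ} (t : Term E.sig n) (us : ∀ i, Term E.sig (k i)) :
    E.fp.comp (E.cls t) (fun i => E.cls (us i)) = E.cls (t.blockGraft us) := by
  rw [E.fp.comp_eq_cloneComp]
  simp only [act_cls, cloneComp_cls, Term.blockGraft]

theorem cls_op {n m : ℕ} (φ : E.sig m) (ts : Fin m → Term E.sig n) :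
    E.cls (.op φ ts) = E.fp.cloneComp (E.gen φ) fun i => E.cls (ts i) := by
  rw [gen, cloneComp_cls]
  rfl

theorem cls_eq_of_mem {n : ℕ} {s t : Term E.sig n} (h : (s, t) ∈ E.eqns n) : E.cls s = E.cls t :=
  Quotient.sound (Closure.of h)

variable {E} {Q : FPOperad.{u}}

/-- Soundness of equational deduction: evaluation turns grafting into clone composition, so it
respects each closure rule. -/
theorem Closure.eval_eq (a : ∀ m : ℕ, E.sig m → Q.Op m)
    (ha : ∀ (n : ℕ), ∀ e ∈ E.eqns n, e.1.eval Q a = e.2.eval Q a)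
    {n : ℕ} {s t : Term E.sig n} (h : E.Closure s t) : s.eval Q a = t.eval Q a := by
  induction h with
  | of h => exact ha _ _ h
  | refl t => rfl
  | symm _ ih => exact ih.symm
  | trans _ _ ih ih' => exact ih.trans ih'
  | graft_left us _ ih => rw [Term.eval_graft, Term.eval_graft, ih]
  | graft_right t _ ih => simp only [Term.eval_graft, ih]

/-- The universal property of the finite product operad of a presentation. -/
noncomputable def lift (a : ∀ m : ℕ, E.sig m → Q.Op m)
    (ha : ∀ (n : ℕ), ∀ e ∈ E.eqns n, e.1.eval Q a = e.2.eval Q a) : FPOperad.Hom E.fp Q :=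
  FPOperad.homOfMap (Q := E.fp)
    (fun {n} => Quotient.lift (s := E.closureSetoid n) (Term.eval Q a)
      fun _ _ h => Closure.eval_eq a ha h)
    (fun {n m} f g => by
      obtain ⟨t, rfl⟩ := E.exists_cls_eq f
      choose us hus using fun i => E.exists_cls_eq (g i)
      obtain rfl : _ = g := funext hus
      rw [cloneComp_cls]
      exact Term.eval_graft Q a t us)
    (fun i => by
      rw [← cls_var]
      rfl)

theorem lift_gen (a : ∀ m : ℕ, E.sig m → Q.Op m)
    (ha : ∀ (n : ℕ), ∀ e ∈ E.eqns n, e.1.eval Q a = e.2.eval Q a) {n : ℕ} (φ : E.sig n) :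
    (lift a ha).map (E.gen φ) = a n φ := Q.cloneComp_proj (a n φ)

theorem map_cls (F : FPOperad.Hom E.fp Q) {n : ℕ} (t : Term E.sig n) :
    F.map (E.cls t) = t.eval Q fun _ φ => F.map (E.gen φ) := by
  induction t with
  | var i =>
    rw [cls_var]
    exact F.toClone.map_proj i
  | op φ ts ih =>
    rw [cls_op]
    refine (F.toClone.map_comp (E.gen φ) fun i => E.cls (ts i)).trans ?_
    exact congrArg (Q.cloneComp (F.map (E.gen φ))) (funext ih)

/-- Every operation is an iterated clone composite of generators and projections. -/
theorem hom_ext {F G : FPOperad.Hom E.fp Q}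
    (h : ∀ {n : ℕ} (φ : E.sig n), F.map (E.gen φ) = G.map (E.gen φ)) : F = G := by
  refine FPOperad.Hom.ext ?_
  funext n x
  obtain ⟨t, rfl⟩ := E.exists_cls_eq x
  simp only [map_cls, h]

end Presentation

/-! ## The free finite product operads -/

namespace PlainOperad

/-- The equations that hold between the operations of a plain operad. -/
inductive Eqn (P : PlainOperad.{u}) : ∀ {n : ℕ}, Term P.Op n → Term P.Op n → Prop
  | one : Eqn P (.op P.one .var) (.var 0)
  | comp {n : ℕ} {k : Fin n → ℕ} (p : P.Op n) (q : ∀ i, P.Op (k i)) :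
      Eqn P (.op (P.comp p q) .var) (.op p fun i => .op (q i) fun j => .var (blockIncl k i j))

theorem Eqn.isStronglyRegular {P : PlainOperad.{u}} {n : ℕ} {s t : Term P.Op n}
    (h : P.Eqn s t) : s.IsStronglyRegular ∧ t.IsStronglyRegular := by
  simp only [Term.isStronglyRegular_iff]
  cases h with
  | one => exact ⟨(Term.vars_op_var _ id).trans (List.map_id _), rfl⟩
  | comp p q =>
    refine ⟨(Term.vars_op_var _ id).trans (List.map_id _), ?_⟩
    simp only [Term.vars_op p, Term.vars_op_var, flatMap_blockIncl]

theorem Eqn.eval_eq {P : PlainOperad.{u}} {Q : FPOperad.{u}} (F : Hom P Q.toPlainOperad) {n : ℕ}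
    {s t : Term P.Op n} (h : P.Eqn s t) :
    s.eval Q (fun _ p => F.map p) = t.eval Q (fun _ p => F.map p) := by
  cases h with
  | one =>
    refine (Term.eval_op_var Q _ _ id).trans ?_
    rw [Q.act_id, F.map_one, Q.one_eq_cloneProj]
    rfl
  | comp p q =>
    refine (Term.eval_op_var Q _ _ id).trans ?_
    rw [Q.act_id, F.map_comp, Q.comp_eq_cloneComp]
    simp only [Term.eval, Q.act_eq_cloneComp]

/-- The morphism from a plain operad to the finite product operad of a presentation whose symbols
are the operations of the plain operad. -/
def genHom (P : PlainOperad.{u}) (eqns : ∀ n : ℕ, Set (Term P.Op n × Term P.Op n))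
    (h : ∀ {n : ℕ} {s t : Term P.Op n}, P.Eqn s t → (s, t) ∈ eqns n) :
    Hom P (Presentation.mk P.Op eqns).fp.toPlainOperad where
  map p := Presentation.gen _ p
  map_one := Presentation.cls_eq_of_mem _ (h .one)
  map_comp p q := by
    refine (Presentation.cls_eq_of_mem _ (h (.comp p q))).trans ?_
    refine Eq.trans ?_ (Presentation.comp_cls _ _ _).symm
    rfl

/-- The strongly regular presentation of the free finite product operad on a plain operad. -/
def presentation (P : PlainOperad.{u}) : Presentation.{u} where
  sig := P.Op
  eqns _ := {e | P.Eqn e.1 e.2}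

theorem presentation_isStronglyRegular (P : PlainOperad.{u}) :
    P.presentation.IsStronglyRegular := fun _ _ h => Eqn.isStronglyRegular h

/-- The extension of a morphism to the free finite product operad. -/
noncomputable def extend {P : PlainOperad.{u}} {Q : FPOperad.{u}} (F : Hom P Q.toPlainOperad) :
    FPOperad.Hom P.presentation.fp Q :=
  Presentation.lift (fun _ p => F.map p) fun _ _ h => Eqn.eval_eq F h

theorem extend_gen {P : PlainOperad.{u}} {Q : FPOperad.{u}} (F : Hom P Q.toPlainOperad) {n : ℕ}
    (p : P.Op n) : (extend F).map (P.presentation.gen p) = F.map p :=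
  Presentation.lift_gen (E := P.presentation) _ _ p

/-- The universal property of the free finite product operad on a plain operad. -/
noncomputable def fpHomEquiv (P : PlainOperad.{u}) (Q : FPOperad.{u}) :
    (P.presentation.fp ⟶ Q) ≃ (P ⟶ FPOperad.forgetToPlain.obj Q) where
  toFun F := P.genHom _ (fun h => h) ≫ FPOperad.forgetToPlain.map F
  invFun F := extend F
  left_inv _ := Presentation.hom_ext (E := P.presentation) fun p => extend_gen _ p
  right_inv F := PlainOperad.Hom.ext (funext fun _ => funext fun p => extend_gen F p)

/-- The free finite product operad on a plain operad. -/
noncomputable def freeFP : PlainOperad.{u} ⥤ FPOperad.{u} :=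
  Adjunction.leftAdjointOfEquiv fpHomEquiv fun _ _ _ _ _ => rfl

/-- The adjunction between the free and the forgetful functor. -/
noncomputable def freeFPAdjunction : freeFP.{u} ⊣ FPOperad.forgetToPlain.{u} :=
  Adjunction.adjunctionOfEquivLeft fpHomEquiv fun _ _ _ _ _ => rfl

end PlainOperad

namespace SymmOperad

/-- The equations that hold between the operations of a symmetric operad. -/
inductive Eqn (P : SymmOperad.{u}) : ∀ {n : ℕ}, Term P.Op n → Term P.Op n → Prop
  | plain {n : ℕ} {s t : Term P.Op n} (h : P.toPlainOperad.Eqn s t) : Eqn P s t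
  | act {n m : ℕ} (σ : Fin n ≃ Fin m) (p : P.Op n) :
      Eqn P (.op (P.act σ p) .var) (.op p fun i => .var (σ i))

theorem Eqn.isLinear {P : SymmOperad.{u}} {n : ℕ} {s t : Term P.Op n}
    (h : P.Eqn s t) : s.IsLinear ∧ t.IsLinear := by
  have hvar {n : ℕ} (p : P.Op n) : (Term.op p .var).IsLinear :=
    Term.isLinear_of_vars_eq ((Term.vars_op_var p id).trans (List.map_id _))
  cases h with
  | plain h => exact h.isStronglyRegular.imp (fun h => h.isLinear) fun h => h.isLinear
  | act σ p => exact ⟨hvar _, (hvar p).graft_equiv σ⟩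

theorem Eqn.eval_eq {P : SymmOperad.{u}} {Q : FPOperad.{u}} (F : Hom P Q.toSymmOperad) {n : ℕ}
    {s t : Term P.Op n} (h : P.Eqn s t) :
    s.eval Q (fun _ p => F.map p) = t.eval Q (fun _ p => F.map p) := by
  cases h with
  | plain h => exact h.eval_eq F.toHom
  | act σ p =>
    refine (Term.eval_op_var Q _ _ id).trans ?_
    exact (Q.act_id _).trans ((F.map_act σ p).trans (Term.eval_op_var Q _ p σ).symm)

/-- The linear presentation of the free finite product operad on a symmetric operad. -/
def presentation (P : SymmOperad.{u}) : Presentation.{u} where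
  sig := P.Op
  eqns _ := {e | P.Eqn e.1 e.2}

theorem presentation_isLinear (P : SymmOperad.{u}) : P.presentation.IsLinear :=
  fun _ _ h => Eqn.isLinear h

/-- The morphism from a symmetric operad to the free finite product operad on it. -/
def genHom (P : SymmOperad.{u}) : Hom P P.presentation.fp.toSymmOperad where
  toHom := P.toPlainOperad.genHom _ fun h => .plain h
  map_act σ p :=
    (Presentation.cls_eq_of_mem P.presentation (.act σ p)).trans
      (Presentation.act_cls P.presentation σ (.op p .var)).symm

/-- The extension of a morphism to the free finite product operad. -/
noncomputable def extend {P : SymmOperad.{u}} {Q : FPOperad.{u}} (F : Hom P Q.toSymmOperad) :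
    FPOperad.Hom P.presentation.fp Q :=
  Presentation.lift (fun _ p => F.map p) fun _ _ h => Eqn.eval_eq F h

theorem extend_gen {P : SymmOperad.{u}} {Q : FPOperad.{u}} (F : Hom P Q.toSymmOperad) {n : ℕ}
    (p : P.Op n) : (extend F).map (P.presentation.gen p) = F.map p :=
  Presentation.lift_gen (E := P.presentation) _ _ p

/-- The universal property of the free finite product operad on a symmetric operad. -/
noncomputable def fpHomEquiv (P : SymmOperad.{u}) (Q : FPOperad.{u}) :
    (P.presentation.fp ⟶ Q) ≃ (P ⟶ FPOperad.forgetToSymm.obj Q) where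
  toFun F := P.genHom ≫ FPOperad.forgetToSymm.map F
  invFun F := extend F
  left_inv _ := Presentation.hom_ext (E := P.presentation) fun p => extend_gen _ p
  right_inv F := SymmOperad.Hom.ext (funext fun _ => funext fun p => extend_gen F p)

/-- The free finite product operad on a symmetric operad. -/
noncomputable def freeFP : SymmOperad.{u} ⥤ FPOperad.{u} :=
  Adjunction.leftAdjointOfEquiv fpHomEquiv fun _ _ _ _ _ => rfl

/-- The adjunction between the free and the forgetful functor. -/
noncomputable def freeFPAdjunction : freeFP.{u} ⊣ FPOperad.forgetToSymm.{u} :=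
  Adjunction.adjunctionOfEquivLeft fpHomEquiv fun _ _ _ _ _ => rfl

end SymmOperad

/-! ## Suboperads -/

theorem subtype_heq {A : ℕ → Type u} {S : ∀ n, Set (A n)} {a b : ℕ} (h : a = b) {x : S a} {y : S b}
    (hxy : HEq x.1 y.1) : HEq x y := by
  subst h
  exact heq_of_eq (Subtype.ext (eq_of_heq hxy))

/-- The plain operad on a set of operations closed under composition. -/
def PlainOperad.sub (R : PlainOperad.{u}) (S : ∀ n, Set (R.Op n)) (h_one : R.one ∈ S 1)
    (h_comp : ∀ {n : ℕ} {k : Fin n → ℕ} (p : R.Op n) (q : ∀ i, R.Op (k i)), p ∈ S n →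
      (∀ i, q i ∈ S (k i)) → R.comp p q ∈ S (∑ i, k i)) : PlainOperad.{u} where
  Op n := S n
  one := ⟨R.one, h_one⟩
  comp p q := ⟨R.comp p.1 fun i => (q i).1, h_comp _ _ p.2 fun i => (q i).2⟩
  one_comp {n} p := subtype_heq (by simp) (R.one_comp p.1)
  comp_one {n} p := subtype_heq (by simp) (R.comp_one p.1)
  comp_assoc {n k l} f g h := subtype_heq (sum_sum_blocks k l)
    (R.comp_assoc f.1 (fun i => (g i).1) fun i j => (h i j).1)

namespace Presentation

variable (E : Presentation.{u})

/-- The operations represented by strongly regular terms. -/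
noncomputable def regularOps : PlainOperad.{u} :=
  E.fp.toPlainOperad.sub (fun _ => {x | ∃ t, t.IsStronglyRegular ∧ E.cls t = x})
    ⟨.var 0, (Term.isStronglyRegular_iff _).2 rfl, rfl⟩
    (by
      rintro n k _ q ⟨t, ht, rfl⟩ hq
      choose us hus hq using hq
      obtain rfl : _ = q := funext hq
      exact ⟨t.blockGraft us, ht.blockGraft hus, (E.comp_cls t us).symm⟩)

/-- The operations represented by linear terms, as a plain operad. -/
noncomputable def linearOpsPlain : PlainOperad.{u} :=
  E.fp.toPlainOperad.sub (fun _ => {x | ∃ t, t.IsLinear ∧ E.cls t = x})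
    ⟨.var 0, Term.isLinear_of_vars_eq rfl, rfl⟩
    (by
      rintro n k _ q ⟨t, ht, rfl⟩ hq
      choose us hus hq using hq
      obtain rfl : _ = q := funext hq
      exact ⟨t.blockGraft us, ht.blockGraft hus, (E.comp_cls t us).symm⟩)

/-- The operations represented by linear terms. -/
noncomputable def linearOps : SymmOperad.{u} where
  toPlainOperad := E.linearOpsPlain
  act σ p := ⟨E.fp.act σ p.1, by
    obtain ⟨t, ht, h⟩ := p.2
    exact ⟨_, ht.graft_equiv σ, by rw [← h, act_cls]⟩⟩
  act_refl p := Subtype.ext (E.fp.act_id p.1)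
  act_act ρ σ p := Subtype.ext (E.fp.act_act ρ σ p.1)
  act_comp_act σ τ p q := Subtype.ext
    (E.fp.act_comp_act σ (fun i => τ i) p.1 fun i => (q i).1)

/-- The inclusion of the operations represented by strongly regular terms. -/
noncomputable def regularOpsIncl : PlainOperad.Hom E.regularOps E.fp.toPlainOperad where
  map x := x.1
  map_one := rfl
  map_comp _ _ := rfl

/-- The inclusion of the operations represented by linear terms. -/
noncomputable def linearOpsIncl : SymmOperad.Hom E.linearOps E.fp.toSymmOperad where
  map x := x.1
  map_one := rfl
  map_comp _ _ := rfl
  map_act _ _ := rfl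

variable {E}

/-- A strongly regular term as an element of `regularOps`. -/
noncomputable def regularCls {n : ℕ} (t : Term E.sig n) (h : t.IsStronglyRegular) :
    E.regularOps.Op n :=
  ⟨E.cls t, t, h, rfl⟩

/-- A linear term as an element of `linearOps`. -/
noncomputable def linearCls {n : ℕ} (t : Term E.sig n) (h : t.IsLinear) : E.linearOps.Op n :=
  ⟨E.cls t, t, h, rfl⟩

/-- The inclusion of the operations represented by strongly regular terms into those represented
by linear terms. -/
noncomputable def regularToLinear : PlainOperad.Hom E.regularOps E.linearOps.toPlainOperad where
  map x := ⟨x.1, x.2.imp fun _ h => h.imp_left fun h => h.isLinear⟩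
  map_one := rfl
  map_comp _ _ := rfl

theorem isStronglyRegular_op_var {n : ℕ} (φ : E.sig n) :
    (Term.op φ .var).IsStronglyRegular :=
  (Term.isStronglyRegular_iff _).2 ((Term.vars_op_var φ id).trans (List.map_id _))

/-! ### Evaluating terms through strongly regular terms and relabellings. -/

variable {T : FPOperad.{u}}

/-- The assignment of operations to symbols given by a morphism from `regularOps`. -/
noncomputable def assign (η : PlainOperad.Hom E.regularOps T.toPlainOperad) (n : ℕ)
    (φ : E.sig n) : T.Op n :=
  η.map (regularCls (.op φ .var) (isStronglyRegular_op_var φ))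

/-- Give each occurrence of a variable its own name, in order; `f` restores the old names. Arbitrary
terms are needed for the induction, as the subterms of a strongly regular `n`-ary term need not be
strongly regular as `n`-ary terms. -/
theorem exists_regular_eval_eq (η : PlainOperad.Hom E.regularOps T.toPlainOperad) {n : ℕ}
    (t : Term E.sig n) :
    ∃ (m : ℕ) (t' : Term E.sig m) (h : t'.IsStronglyRegular) (f : Fin m → Fin n),
      t = t'.graft (fun i => .var (f i)) ∧
        t.eval T (assign η) = T.act f (η.map (regularCls t' h)) := by
  induction t with
  | var i =>
    refine ⟨1, .var 0, (Term.isStronglyRegular_iff _).2 rfl, fun _ => i, rfl, ?_⟩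
    exact congrArg (T.act _) η.map_one.symm
  | op φ ts ih =>
    choose k t' h f hf he using ih
    have hg : ∀ i j, f i j = (fun x : Fin (∑ i, k i) => f (finSigmaFinEquiv.symm x).1
        (finSigmaFinEquiv.symm x).2) (blockIncl k i j) := fun i j => by
      have key : ∀ y : (i : _) × Fin (k i), y = ⟨i, j⟩ → f i j = f y.1 y.2 := by
        rintro _ rfl
        rfl
      exact key _ (Equiv.symm_apply_apply _ _)
    -- The relabellings `f i` are glued along the blocks; only the restrictions of `g` to the blocks
    -- matter from here on.
    generalize (fun x : Fin (∑ i, k i) => f (finSigmaFinEquiv.symm x).1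
        (finSigmaFinEquiv.symm x).2) = g at hg
    have hr := (isStronglyRegular_op_var φ).blockGraft h
    refine ⟨∑ i, k i, (Term.op φ .var).blockGraft t', hr, g, ?_, ?_⟩
    · rw [Term.blockGraft, Term.graft_graft]
      simp only [Term.graft, Term.graft_graft, ← hg, ← hf]
    -- The class of the composite term is an operadic composite inside `regularOps`, so `η` can be
    -- applied factor by factor.
    · have h₁ : regularCls ((Term.op φ .var).blockGraft t') hr =
          E.regularOps.comp (regularCls (.op φ .var) (isStronglyRegular_op_var φ))
            fun i => regularCls (t' i) (h i) :=
        Subtype.ext (E.comp_cls (.op φ .var) t').symm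
      rw [h₁, η.map_comp, T.comp_eq_cloneComp, T.act_cloneComp]
      simp only [Term.eval, he, T.act_act, Function.comp_def, ← hg]
      rfl

theorem eval_eq_of_isStronglyRegular (η : PlainOperad.Hom E.regularOps T.toPlainOperad) {n : ℕ}
    (t : Term E.sig n) (ht : t.IsStronglyRegular) :
    t.eval T (assign η) = η.map (regularCls t ht) := by
  obtain ⟨m, t', h, f, rfl, he⟩ := exists_regular_eval_eq η t
  rw [he]
  have hv := (Term.isStronglyRegular_iff _).1 ht
  rw [Term.vars_graft_var, (Term.isStronglyRegular_iff _).1 h] at hv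
  -- The variable list of the relabelled term is `1, …, m` mapped by `f`, and it equals `1, …, n`:
  -- lengths give `m = n`, entries give `f = id`.
  obtain rfl : m = n := by simpa using congrArg List.length hv
  obtain rfl : f = id := by
    funext i
    exact List.map_eq_map_iff.1 (hv.trans (List.map_id _).symm) i (List.mem_finRange i)
  rw [T.act_id]
  congr 1
  exact Subtype.ext (congrArg E.cls (Term.graft_var t').symm)

theorem eval_eq_of_isLinear (η : SymmOperad.Hom E.linearOps T.toSymmOperad) {n : ℕ}
    (t : Term E.sig n) (ht : t.IsLinear) :
    t.eval T (fun _ φ => η.map (linearCls (.op φ .var) (isStronglyRegular_op_var φ).isLinear)) =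
      η.map (linearCls t ht) := by
  -- Restricting `η` to strongly regular classes leaves the values on symbols unchanged, so the
  -- decomposition of `t` applies.
  let η' : PlainOperad.Hom E.regularOps T.toPlainOperad :=
    { map := fun x => η.map (regularToLinear.map x)
      map_one := η.map_one
      map_comp := fun p q => η.map_comp (regularToLinear.map p) fun i => regularToLinear.map (q i) }
  obtain ⟨m, t', h, f, rfl, he⟩ := exists_regular_eval_eq η' t
  have hv := (Term.isLinear_iff _).1 ht
  rw [Term.vars_graft_var, (Term.isStronglyRegular_iff _).1 h] at hv
  -- Injectivity is the absence of repetitions in the variable list, surjectivity the presence of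
  -- every variable.
  have hf : Function.Bijective f := by
    refine ⟨fun i j hij => List.inj_on_of_nodup_map hv.1 (List.mem_finRange i)
      (List.mem_finRange j) hij, fun i => ?_⟩
    obtain ⟨j, -, hj⟩ := List.mem_map.1 (hv.2 i)
    exact ⟨j, hj⟩
  refine he.trans ((η.map_act (Equiv.ofBijective f hf) (linearCls t' h.isLinear)).symm.trans ?_)
  exact congrArg η.map (Subtype.ext (E.act_cls f t'))

/-! ## Presentations by strongly regular and by linear equations -/

/-- The adjunction is arbitrary because `leftAdjoint` in the main theorem is an unspecified choice.
The inverse maps are `ε`, the transpose of the inclusion, and `ρ`, the extension of `η` from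
symbols. -/
theorem IsStronglyRegular.nonempty_iso (hE : E.IsStronglyRegular)
    {F : PlainOperad.{u} ⥤ FPOperad.{u}} (adj : F ⊣ FPOperad.forgetToPlain) :
    Nonempty (E.fp ≅ F.obj E.regularOps) := by
  let η : PlainOperad.Hom E.regularOps (F.obj E.regularOps).toPlainOperad :=
    adj.unit.app E.regularOps
  let ε : F.obj E.regularOps ⟶ E.fp := (adj.homEquiv E.regularOps E.fp).symm E.regularOpsIncl
  have hε {n : ℕ} (x : E.regularOps.Op n) : (FPOperad.Hom.toHom ε).map (η.map x) = x.1 :=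
    congrArg (fun G : PlainOperad.Hom E.regularOps E.fp.toPlainOperad => G.map x)
      ((adj.homEquiv_unit _ _ ε).symm.trans (Equiv.apply_symm_apply _ _))
  -- Strong regularity of the equations enters here: both sides define the same element of
  -- `regularOps`, so `η` gives them the same value.
  let ρ : E.fp ⟶ F.obj E.regularOps := lift (assign η) fun n e he => by
    obtain ⟨h₁, h₂⟩ := hE n e he
    rw [eval_eq_of_isStronglyRegular η _ h₁, eval_eq_of_isStronglyRegular η _ h₂]
    exact congrArg η.map (Subtype.ext (E.cls_eq_of_mem he))
  have hρ {n : ℕ} (t : Term E.sig n) (ht : t.IsStronglyRegular) :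
      (FPOperad.Hom.toHom ρ).map (E.cls t) = η.map (regularCls t ht) :=
    eval_eq_of_isStronglyRegular η t ht
  refine ⟨ρ, ε, ?_, ?_⟩
  · refine hom_ext fun φ => ?_
    exact (congrArg (FPOperad.Hom.toHom ε).map (hρ _ (isStronglyRegular_op_var φ))).trans (hε _)
  -- By adjointness it suffices to compare after composing with the unit, where each element is the
  -- class of a strongly regular term and `ρ (ε (η x)) = ρ x = η x`.
  · refine (adj.homEquiv _ _).injective ?_
    rw [adj.homEquiv_unit, adj.homEquiv_unit]
    refine PlainOperad.Hom.ext (funext fun n => funext fun x => ?_)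
    obtain ⟨_, t, ht, rfl⟩ := x
    exact (congrArg (FPOperad.Hom.toHom ρ).map (hε _)).trans (hρ t ht)

/-- Same argument, with `eval_eq_of_isLinear` supplying the equations in the free object. -/
theorem IsLinear.nonempty_iso (hE : E.IsLinear)
    {F : SymmOperad.{u} ⥤ FPOperad.{u}} (adj : F ⊣ FPOperad.forgetToSymm) :
    Nonempty (E.fp ≅ F.obj E.linearOps) := by
  let η : SymmOperad.Hom E.linearOps (F.obj E.linearOps).toSymmOperad :=
    adj.unit.app E.linearOps
  let ε : F.obj E.linearOps ⟶ E.fp := (adj.homEquiv E.linearOps E.fp).symm E.linearOpsIncl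
  have hε {n : ℕ} (x : E.linearOps.Op n) : (FPOperad.Hom.toHom ε).map (η.map x) = x.1 :=
    congrArg (fun G : SymmOperad.Hom E.linearOps E.fp.toSymmOperad => G.map x)
      ((adj.homEquiv_unit _ _ ε).symm.trans (Equiv.apply_symm_apply _ _))
  let ρ : E.fp ⟶ F.obj E.linearOps :=
    lift (fun _ φ => η.map (linearCls (.op φ .var) (isStronglyRegular_op_var φ).isLinear))
      fun n e he => by
        obtain ⟨h₁, h₂⟩ := hE n e he
        rw [eval_eq_of_isLinear η _ h₁, eval_eq_of_isLinear η _ h₂]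
        exact congrArg η.map (Subtype.ext (E.cls_eq_of_mem he))
  have hρ {n : ℕ} (t : Term E.sig n) (ht : t.IsLinear) :
      (FPOperad.Hom.toHom ρ).map (E.cls t) = η.map (linearCls t ht) :=
    eval_eq_of_isLinear η t ht
  refine ⟨ρ, ε, ?_, ?_⟩
  · refine hom_ext fun φ => ?_
    exact (congrArg (FPOperad.Hom.toHom ε).map (hρ _ (isStronglyRegular_op_var φ).isLinear)).trans
      (hε _)
  · refine (adj.homEquiv _ _).injective ?_
    rw [adj.homEquiv_unit, adj.homEquiv_unit]
    refine SymmOperad.Hom.ext (funext fun n => funext fun x => ?_)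
    obtain ⟨_, t, ht, rfl⟩ := x
    exact (congrArg (FPOperad.Hom.toHom ρ).map (hε _)).trans (hρ t ht)

end Presentation

/-! ### Characterisation of the strongly regular and the linear finite product operads. -/

namespace FPOperad

/-- A finite product operad whose clone is presented by `E` is isomorphic to `E.fp`. -/
noncomputable def isoFP {Q : FPOperad.{u}} {E : Presentation.{u}} (e : Q.clone ≅ E.clone) :
    Q ≅ E.fp :=
  isoOfCloneIso (e ≪≫ E.clone.toFPCloneIso.symm)

/-- The clone of a finite product operad isomorphic to `E.fp` is presented by `E`. -/
noncomputable def cloneIsoOfIsoFP {Q : FPOperad.{u}} {E : Presentation.{u}} (e : Q ≅ E.fp) :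
    Q.clone ≅ E.clone :=
  cloneIso e ≪≫ E.clone.toFPCloneIso

theorem isStronglyRegular_iff (Q : FPOperad.{u}) {F : PlainOperad.{u} ⥤ FPOperad.{u}}
    (adj : F ⊣ forgetToPlain) :
    Q.IsStronglyRegular ↔ ∃ P : PlainOperad.{u}, Nonempty (Q ≅ F.obj P) := by
  constructor
  · rintro ⟨E, hE, ⟨e⟩⟩
    obtain ⟨i⟩ := hE.nonempty_iso adj
    exact ⟨_, ⟨isoFP e ≪≫ i⟩⟩
  · rintro ⟨P, ⟨e⟩⟩
    -- Uniqueness of left adjoints replaces `F` by the explicit `freeFP`, whose value at `P` is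
    -- `P.presentation.fp`.
    exact ⟨P.presentation, P.presentation_isStronglyRegular,
      ⟨cloneIsoOfIsoFP
        (e ≪≫ (adj.leftAdjointUniq PlainOperad.freeFPAdjunction).app P)⟩⟩

theorem isLinear_iff (Q : FPOperad.{u}) {F : SymmOperad.{u} ⥤ FPOperad.{u}}
    (adj : F ⊣ forgetToSymm) :
    Q.IsLinear ↔ ∃ P : SymmOperad.{u}, Nonempty (Q ≅ F.obj P) := by
  constructor
  · rintro ⟨E, hE, ⟨e⟩⟩
    obtain ⟨i⟩ := hE.nonempty_iso adj
    exact ⟨_, ⟨isoFP e ≪≫ i⟩⟩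
  · rintro ⟨P, ⟨e⟩⟩
    exact ⟨P.presentation, P.presentation_isLinear,
      ⟨cloneIsoOfIsoFP
        (e ≪≫ (adj.leftAdjointUniq SymmOperad.freeFPAdjunction).app P)⟩⟩

end FPOperad

end UA

theorem mainTheorem5 :
    (∃ _ : UA.FPOperad.forgetToPlain.{u}.IsRightAdjoint,
      ∀ Q : UA.FPOperad.{u}, Q.IsStronglyRegular ↔
        ∃ P : UA.PlainOperad.{u},
          Nonempty (Q ≅ UA.FPOperad.forgetToPlain.{u}.leftAdjoint.obj P)) ∧
    (∃ _ : UA.FPOperad.forgetToSymm.{u}.IsRightAdjoint,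
      ∀ Q : UA.FPOperad.{u}, Q.IsLinear ↔
        ∃ P : UA.SymmOperad.{u},
          Nonempty (Q ≅ UA.FPOperad.forgetToSymm.{u}.leftAdjoint.obj P)) :=
  ⟨⟨UA.PlainOperad.freeFPAdjunction.isRightAdjoint, fun Q =>
      have := UA.PlainOperad.freeFPAdjunction.{u}.isRightAdjoint
      Q.isStronglyRegular_iff (Adjunction.ofIsRightAdjoint _)⟩,
    ⟨UA.SymmOperad.freeFPAdjunction.isRightAdjoint, fun Q =>
      have := UA.SymmOperad.freeFPAdjunction.{u}.isRightAdjoint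
      Q.isLinear_iff (Adjunction.ofIsRightAdjoint _)⟩⟩
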